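/- Let $d \geq 1$ and let $G = (V,E)$ be a finite simple graph. For $F \subseteq E$ let $r_d(F)$ denote the rank of $F$ in the $d$-dimensional rigidity matroid of $G$: the rank of the rows indexed by $F$ of the rigidity matrix $R(G,p)$, where $p : V \to \mathbb{R}^d$ is any configuration whose $d|V|$ coordinates are algebraically independent over $\mathbb{Q}$, and where the row of $R(G,p)$ belonging to an edge $uv$ has the entries $p(u)-p(v)$ in the $d$ columns of $u$, $p(v)-p(u)$ in the $d$ columns of $v$, and zeros elsewhere (this rank does not depend on the choice of $p$). For a graph $H$ let $m_{d,H} : (\mathbb{C}^d)^{V(H)} \to \mathbb{C}^{E(H)}$ be the map $m_{d,H}(p) = \big(\sum_{k=1}^d (p(u)_k - p(v)_k)^2\big)_{uv \in E(H)}$, and let the measurement variety $M_{d,H} \subseteq \mathbb{C}^{E(H)}$ be the Zariski closure of the image of $m_{d,H}$. Suppose that $E = E_1 \cup E_2$ is a partition of $E$ into two non-empty (disjoint) subsets with $r_d(E) = r_d(E_1) + r_d(E_2)$. Let $G_1$ and $G_2$ be the subgraphs of $G$ induced by $E_1$ and $E_2$, respectively ($G_i$ has edge set $E_i$, and its vertices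 are the endpoints of these edges). Then $$M_{d,G} = M_{d,G_1} \times M_{d,G_2}$$ under the identification $\mathbb{C}^E = \mathbb{C}^{E_1} \times \mathbb{C}^{E_2}$. -/

import Mathlib

namespace Rigidity

/-! ### The edge measurement map and the measurement variety -/

/-- The squared length `∑ₖ (p(u)ₖ - p(v)ₖ)²` of the pair `uv` in the configuration `p`
(no conjugation is used, also over `ℂ`). -/
def sqLength {V R : Type*} [CommRing R] {d : ℕ} (p : V → Fin d → R) : Sym2 V → R :=
  Sym2.lift ⟨fun u v => ∑ k, (p u k - p v k) ^ 2, fun u v =>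
    Finset.sum_congr rfl fun k _ => by ring⟩

/-- The complex `d`-dimensional edge measurement map `m_{d,G} : (ℂ^d)^V → ℂ^E`. -/
def measurementMap {V : Type*} (d : ℕ) (G : SimpleGraph V) (p : V → Fin d → ℂ) :
    G.edgeSet → ℂ :=
  fun e => sqLength p (e : Sym2 V)

/-- The Zariski closure of a subset of the complex affine space `ℂ^σ`: the common zeros of all
polynomials that vanish on the set. -/
noncomputable def zariskiClosure {σ : Type*} (S : Set (σ → ℂ)) : Set (σ → ℂ) :=
  MvPolynomial.zeroLocus ℂ (MvPolynomial.vanishingIdeal ℂ S)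

/-- The `d`-dimensional measurement variety `M_{d,G} ⊆ ℂ^E`. -/
noncomputable def measurementVariety {V : Type*} (d : ℕ) (G : SimpleGraph V) :
    Set (G.edgeSet → ℂ) :=
  zariskiClosure (Set.range (measurementMap d G))

/-! ### The rigidity matrix and the rank function of the rigidity matroid -/

open scoped Classical in
/-- The row of the rigidity matrix that belongs to the pair `uv`: the coordinates of
`p(u) - p(v)` in the columns of `u`, those of `p(v) - p(u)` in the columns of `v`, and zeros
elsewhere. -/
noncomputable def rigidityRow {V R : Type*} [CommRing R] {d : ℕ} (p : V → Fin d → R) :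
    Sym2 V → V × Fin d → R :=
  Sym2.lift ⟨fun u v c =>
      (if c.1 = u then p u c.2 - p v c.2 else 0) + (if c.1 = v then p v c.2 - p u c.2 else 0),
    fun u v => by funext c; exact add_comm _ _⟩

/-- The rigidity matrix `R(G,p)`, with rows indexed by the edges of `G` and `d` columns for each
vertex of `G`. -/
noncomputable def rigidityMatrix {V R : Type*} [CommRing R] {d : ℕ} (G : SimpleGraph V)
    (p : V → Fin d → R) : Matrix G.edgeSet (V × Fin d) R :=
  Matrix.of fun e => rigidityRow p (e : Sym2 V)

/-- The rank of a set `F` of edges in the rigidity matroid of the framework `(G,p)`, that is, in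
the matroid on the edge set given by linear independence of the rows of `R(G,p)`. -/
noncomputable def frameworkRank {V K : Type*} [Field K] {d : ℕ} (G : SimpleGraph V)
    (p : V → Fin d → K) (F : Set G.edgeSet) : ℕ :=
  Module.finrank K (Submodule.span K ((fun e => (rigidityMatrix G p).row e) '' F))

/-- A configuration is generic if its coordinates are algebraically independent over `ℚ`. -/
def IsGeneric {V K : Type*} [Field K] [Algebra ℚ K] {d : ℕ} (p : V → Fin d → K) : Prop :=
  AlgebraicIndependent ℚ (fun c : V × Fin d => p c.1 c.2)

theorem exists_isGeneric (V : Type*) [Finite V] (d : ℕ) :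
    ∃ p : V → Fin d → ℝ, IsGeneric p := by
  obtain ⟨s, hs⟩ := exists_isTranscendenceBasis ℚ ℝ
  have hinf : Infinite s := by
    by_contra hfin
    rw [not_infinite_iff_finite] at hfin
    have := hs.isAlgebraic
    have h1 := Algebra.IsAlgebraic.cardinalMk_le_max
      (Algebra.adjoin ℚ (Set.range ((↑) : s → ℝ))) ℝ
    have h2 : Countable (Algebra.adjoin ℚ (Set.range ((↑) : s → ℝ))) := by
      have : Countable (MvPolynomial s ℚ) := by
        rw [← Cardinal.mk_le_aleph0_iff]
        refine MvPolynomial.cardinalMk_le_max_lift.trans ?_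
        simp
      exact hs.1.aevalEquiv.symm.injective.countable
    have h3 := h1.trans (max_le (Cardinal.mk_le_aleph0_iff.2 h2) le_rfl)
    rw [Cardinal.mk_real] at h3
    exact absurd h3 (not_le.2 Cardinal.aleph0_lt_continuum)
  obtain ⟨n, ⟨f⟩⟩ := Finite.exists_equiv_fin (V × Fin d)
  let g : Fin n ↪ s := Fin.valEmbedding.trans (Infinite.natEmbedding s)
  exact ⟨fun v k => (g (f (v, k)) : ℝ), hs.1.comp (fun c => g (f c)) (g.injective.comp f.injective)⟩

/-- A chosen generic real configuration. By `frameworkRank_eq_of_isGeneric` below, the rank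
function defined from it does not depend on the choice. -/
noncomputable def genericConfiguration (V : Type*) [Finite V] (d : ℕ) : V → Fin d → ℝ :=
  (exists_isGeneric V d).choose

theorem isGeneric_genericConfiguration (V : Type*) [Finite V] (d : ℕ) :
    IsGeneric (genericConfiguration V d) :=
  (exists_isGeneric V d).choose_spec

/-- The rank function `r_d` of the `d`-dimensional rigidity matroid `R_d(G) = (E, r_d)`, i.e. of
the rigidity matroid of a generic framework `(G,p)` in `ℝ^d`. -/
noncomputable def rigidityRank {V : Type*} [Finite V] (d : ℕ) (G : SimpleGraph V)
    (F : Set G.edgeSet) : ℕ :=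
  frameworkRank G (genericConfiguration V d) F

/-! #### The rank function does not depend on the generic configuration -/

theorem linearIndependent_row_iff {V K ι : Type*} [Finite V] [Field K] [Algebra ℚ K]
    {d : ℕ} (G : SimpleGraph V) {p : V → Fin d → K} (hp : IsGeneric p) (f : ι → G.edgeSet) :
    LinearIndependent K (fun i => (rigidityMatrix G p).row (f i)) ↔
      LinearIndependent (MvPolynomial (V × Fin d) ℚ) (fun i =>
        (rigidityMatrix G (fun v k => (MvPolynomial.X (v, k) : MvPolynomial (V × Fin d) ℚ))).row
          (f i)) := by
  let φ : MvPolynomial (V × Fin d) ℚ →+* K :=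
    (MvPolynomial.aeval (fun c : V × Fin d => p c.1 c.2) :
      MvPolynomial (V × Fin d) ℚ →ₐ[ℚ] K).toRingHom
  have hφ : Function.Injective φ := hp
  let _ : Algebra (MvPolynomial (V × Fin d) ℚ) K := φ.toAlgebra
  have : FaithfulSMul (MvPolynomial (V × Fin d) ℚ) K :=
    (faithfulSMul_iff_algebraMap_injective _ _).2 hφ
  rw [← linearIndependent_algebraMap_comp_iff (R := MvPolynomial (V × Fin d) ℚ) (S := K)]
  have key : ∀ e : Sym2 V, ∀ c, rigidityRow p e c = φ (rigidityRow
      (fun v k => (MvPolynomial.X (v, k) : MvPolynomial (V × Fin d) ℚ)) e c) := by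
    intro e c
    induction e with
    | _ u v =>
      simp only [rigidityRow, Sym2.lift_mk, map_add, apply_ite φ, map_sub, map_zero]
      simp [φ]
  have : (fun i => (rigidityMatrix G p).row (f i)) = fun i => (algebraMap _ K) ∘
      (rigidityMatrix G
        (fun v k => (MvPolynomial.X (v, k) : MvPolynomial (V × Fin d) ℚ))).row (f i) := by
    funext i c
    exact key _ _
  rw [this]

theorem frameworkRank_le_of_isGeneric {V K L : Type*} [Finite V] [Field K] [Algebra ℚ K]
    [Field L] [Algebra ℚ L] {d : ℕ} (G : SimpleGraph V) {p : V → Fin d → K} {q : V → Fin d → L}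
    (hp : IsGeneric p) (hq : IsGeneric q) (F : Set G.edgeSet) :
    frameworkRank G p F ≤ frameworkRank G q F := by
  obtain ⟨ι, a, ha, hspan, hli⟩ := exists_linearIndependent' K
    (fun e : F => (rigidityMatrix G p).row e)
  have hq' := (linearIndependent_row_iff G hq (fun i => (a i : G.edgeSet))).2
    ((linearIndependent_row_iff G hp (fun i => (a i : G.edgeSet))).1 hli)
  have : Finite ι := Finite.of_injective a ha
  have := Fintype.ofFinite ι
  have himg : (fun e => (rigidityMatrix G p).row e) '' F =
      Set.range (fun e : F => (rigidityMatrix G p).row e) := Set.image_eq_range _ _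
  unfold frameworkRank
  rw [himg, ← hspan, finrank_span_eq_card hli, ← finrank_span_eq_card hq']
  refine Submodule.finrank_mono (Submodule.span_mono ?_)
  rintro _ ⟨i, rfl⟩
  exact ⟨a i, (a i).2, rfl⟩

/-- Any two generic frameworks of `G` in dimension `d`, over `ℝ` or `ℂ`, have the same rank
function. -/
theorem frameworkRank_eq_of_isGeneric {V K L : Type*} [Finite V] [Field K] [Algebra ℚ K]
    [Field L] [Algebra ℚ L] {d : ℕ} (G : SimpleGraph V) {p : V → Fin d → K} {q : V → Fin d → L}
    (hp : IsGeneric p) (hq : IsGeneric q) (F : Set G.edgeSet) :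
    frameworkRank G p F = frameworkRank G q F :=
  le_antisymm (frameworkRank_le_of_isGeneric G hp hq F) (frameworkRank_le_of_isGeneric G hq hp F)

/-! ### Subgraphs induced by edge sets and the splitting of `ℂ^E` -/

/-- The subgraph of `G` induced by a set `F` of edges: its edges are those in `F`, its vertices
the endpoints of these. -/
def edgeInduced {V : Type*} (G : SimpleGraph V) (F : Set G.edgeSet) : G.Subgraph where
  verts := {v | ∃ e ∈ F, v ∈ (e : Sym2 V)}
  Adj u v := ∃ e ∈ F, (e : Sym2 V) = s(u, v)
  adj_sub := by
    rintro u v ⟨e, -, he⟩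
    have := e.2
    rwa [he, SimpleGraph.mem_edgeSet] at this
  edge_vert := by
    rintro u v ⟨e, heF, he⟩
    exact ⟨e, heF, he ▸ Sym2.mem_mk_left u v⟩
  symm := ⟨by
    rintro u v ⟨e, heF, he⟩
    exact ⟨e, heF, he.trans Sym2.eq_swap⟩⟩

/-- The inclusion of the edges of the subgraph induced by `F` into the edges of `G`. -/
def edgeInclusion {V : Type*} (G : SimpleGraph V) (F : Set G.edgeSet) :
    (edgeInduced G F).coe.edgeSet → G.edgeSet :=
  (edgeInduced G F).hom.mapEdgeSet

theorem edgeInclusion_injective {V : Type*} (G : SimpleGraph V) (F : Set G.edgeSet) :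
    Function.Injective (edgeInclusion G F) :=
  SimpleGraph.Hom.mapEdgeSet.injective _ SimpleGraph.Subgraph.hom_injective

theorem range_edgeInclusion {V : Type*} (G : SimpleGraph V) (F : Set G.edgeSet) :
    Set.range (edgeInclusion G F) = F := by
  ext ⟨e, he⟩
  constructor
  · rintro ⟨⟨e', he'⟩, h⟩
    induction e' with
    | _ u v =>
      obtain ⟨x, hxF, hx⟩ := he'
      have : x = ⟨e, he⟩ := by
        rw [← h]
        exact Subtype.ext hx
      exact this ▸ hxF
  · intro h
    induction e with
    | _ u v =>
      exact ⟨⟨s(⟨u, ⟨_, h, Sym2.mem_mk_left u v⟩⟩, ⟨v, ⟨_, h, Sym2.mem_mk_right u v⟩⟩),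
        ⟨_, h, rfl⟩⟩, rfl⟩

/-- Restriction of the coordinates in `ℂ^E` to the edges of the subgraphs induced by `E₁` and
`E₂`. -/
def splitMap {V : Type*} (G : SimpleGraph V) (E₁ E₂ : Set G.edgeSet) :
    (G.edgeSet → ℂ) →ₗ[ℂ]
      ((edgeInduced G E₁).coe.edgeSet → ℂ) × ((edgeInduced G E₂).coe.edgeSet → ℂ) :=
  (LinearMap.funLeft ℂ ℂ (edgeInclusion G E₁)).prod (LinearMap.funLeft ℂ ℂ (edgeInclusion G E₂))

theorem splitMap_bijective {V : Type*} (G : SimpleGraph V) {E₁ E₂ : Set G.edgeSet}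
    (hdisj : Disjoint E₁ E₂) (hunion : E₁ ∪ E₂ = Set.univ) :
    Function.Bijective (splitMap G E₁ E₂) := by
  have hj : Function.Bijective (Sum.elim (edgeInclusion G E₁) (edgeInclusion G E₂)) := by
    refine ⟨(edgeInclusion_injective G E₁).sumElim (edgeInclusion_injective G E₂) ?_, ?_⟩
    · intro a b hab
      have ha : edgeInclusion G E₁ a ∈ E₁ := 
        (range_edgeInclusion G E₁).le ⟨a, rfl⟩
      have hb : edgeInclusion G E₂ b ∈ E₂ := 
        (range_edgeInclusion G E₂).le ⟨b, rfl⟩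
      exact Set.disjoint_left.1 hdisj ha (hab ▸ hb)
    · rw [← Set.range_eq_univ, Set.Sum.elim_range, range_edgeInclusion, range_edgeInclusion,
        hunion]
  refine ⟨fun x y hxy => ?_, fun z => ?_⟩
  · funext e
    obtain ⟨i, rfl⟩ := hj.2 e
    rcases i with i | i
    · exact congrFun (congrArg Prod.fst hxy) i
    · exact congrFun (congrArg Prod.snd hxy) i
  · let φ := Equiv.ofBijective _ hj
    refine ⟨fun e => Sum.elim z.1 z.2 (φ.symm e), Prod.ext ?_ ?_⟩
    · funext i
      exact congrArg (Sum.elim z.1 z.2) (φ.symm_apply_apply (Sum.inl i))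
    · funext i
      exact congrArg (Sum.elim z.1 z.2) (φ.symm_apply_apply (Sum.inr i))

/-- The identification `ℂ^E = ℂ^{E₁} × ℂ^{E₂}` for a partition `E = E₁ ∪ E₂`. -/
noncomputable def splitEquiv {V : Type*} (G : SimpleGraph V) {E₁ E₂ : Set G.edgeSet}
    (hdisj : Disjoint E₁ E₂) (hunion : E₁ ∪ E₂ = Set.univ) :
    (G.edgeSet → ℂ) ≃ₗ[ℂ]
      ((edgeInduced G E₁).coe.edgeSet → ℂ) × ((edgeInduced G E₂).coe.edgeSet → ℂ) :=
  LinearEquiv.ofBijective (splitMap G E₁ E₂) (splitMap_bijective G hdisj hunion)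

end Rigidity

/-! Restricting coordinates gives the inclusion of the measurement variety in the product.
Conversely, let `f` be a polynomial relation between the squared lengths of all edges; it must
survive when the lengths in `E₁` and `E₂` are measured in two unrelated configurations.

In characteristic zero, algebraic independence of rational functions is linear independence of their
differentials (`MvPolynomial.algebraicIndependent_iff_linearIndependent_D`). The differential of a
squared length is twice its rigidity row, so the generic rigidity matroid is the algebraic matroid
of the squared lengths. Additivity of the rank then yields bases `T₁`, `T₂` of the two parts whose
union is independent (`exists_algebraicIndepOn_sqLength`).

Now give the two parts disjoint sets of variables. Identifying the two copies recovers the original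
lengths, which are independent on `T₁ ∪ T₂`, so this specialization is injective on the algebra
generated by the doubled lengths of `T₁ ∪ T₂`. All doubled lengths are algebraic over that algebra;
hence a nonzero value of `f` at them would divide a nonzero element of it, which the specialization
would kill (`MvPolynomial.aeval_eq_zero_of_isAlgebraic_adjoin`). So `f` vanishes at the doubled
lengths, and evaluating the two sets of variables at arbitrary configurations finishes, up to taking
closures one factor at a time. -/

open KaehlerDifferential

/-! ### Differentials and algebraic independence in characteristic zero -/

/-- A derivation that vanishes on `s` vanishes on every element algebraic over the subalgebra
generated by `s`. -/
theorem Derivation.eq_zero_of_isAlgebraic_adjoin {k K M : Type*} [Field k] [Field K] [CharZero K]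
    [Algebra k K] [AddCommGroup M] [Module K M] [Module k M] [IsScalarTower k K M]
    (δ : Derivation k K M) {s : Set K} (hs : ∀ x ∈ s, δ x = 0) {a : K}
    (ha : IsAlgebraic (Algebra.adjoin k s) a) : δ a = 0 := by
  have hA : ∀ r : Algebra.adjoin k s, δ r = 0 := fun r =>
    Derivation.eqOn_adjoin (D1 := δ) (D2 := 0) (fun x hx => hs x hx) r.2
  -- Since `δ` kills the subalgebra, it is linear over it, and the chain rule applies to polynomials
  -- with coefficients there.
  let δ' : Derivation (Algebra.adjoin k s) K M :=
    { toFun := δ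
      map_add' := map_add δ
      map_smul' := fun r x => by
        have := δ.leibniz (r : K) x
        rw [hA, smul_zero, add_zero] at this
        exact this
      map_one_eq_zero' := δ.map_one_eq_zero
      leibniz' := δ.leibniz }
  change δ' a = 0
  have hinj : Function.Injective (algebraMap (Algebra.adjoin k s) K) := Subtype.val_injective
  have : CharZero (Algebra.adjoin k s) :=
    ⟨fun m n h => Nat.cast_injective (R := K) (by simpa using congrArg Subtype.val h)⟩
  -- Descent on the degree replaces a minimal polynomial: either `p'(a) ≠ 0`, and `p'(a) • δ' a = 0`
  -- gives the claim, or `p'` is an annihilator of smaller degree, nonzero in characteristic zero.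
  suffices H : ∀ n, ∀ p : Polynomial (Algebra.adjoin k s), p.natDegree = n → p ≠ 0 →
      Polynomial.aeval a p = 0 → δ' a = 0 by
    obtain ⟨p, hp, hpa⟩ := ha
    exact H _ p rfl hp hpa
  intro n
  induction n using Nat.strong_induction_on with
  | _ n ih =>
    intro p hn hp hpa
    by_cases h : Polynomial.aeval a p.derivative = 0
    · have hdeg : p.natDegree ≠ 0 := by
        intro h0
        rw [Polynomial.eq_C_of_natDegree_eq_zero h0, Polynomial.aeval_C] at hpa
        refine hp ?_
        rw [Polynomial.eq_C_of_natDegree_eq_zero h0,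
          (map_eq_zero_iff _ hinj).1 hpa, Polynomial.C_0]
      refine ih _ (hn ▸ Polynomial.natDegree_derivative_lt hdeg) _ rfl ?_ h
      intro h0
      exact hdeg (Polynomial.derivative_eq_zero.1 h0)
    · have := δ'.map_aeval p a
      rw [hpa, map_zero] at this
      exact (smul_eq_zero.1 this.symm).resolve_left h

/-- The universal derivation, taken modulo the span of the differentials of `s`, is a derivation
vanishing on `s`. -/
theorem KaehlerDifferential.D_mem_span_of_isAlgebraic_adjoin {k K : Type*} [Field k] [Field K]
    [CharZero K] [Algebra k K] {s : Set K} {a : K} (ha : IsAlgebraic (Algebra.adjoin k s) a) :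
    D k K a ∈ Submodule.span K (D k K '' s) := by
  let N := Submodule.span K (D k K '' s)
  have := (N.mkQ.compDer (D k K)).eq_zero_of_isAlgebraic_adjoin (s := s) (fun x hx =>
    (Submodule.Quotient.mk_eq_zero N).2 (Submodule.subset_span ⟨x, hx, rfl⟩)) ha
  exact (Submodule.Quotient.mk_eq_zero N).1 this

theorem AlgebraicIndependent.of_linearIndependent_D {k K ι : Type*} [Field k] [Field K]
    [CharZero K] [Algebra k K] {x : ι → K} (hx : LinearIndependent K (fun i => D k K (x i))) :
    AlgebraicIndependent k x := by
  refine algebraicIndependent_of_set_of_finite ∅ ?_ ?_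
  · rw [algebraicIndependent_empty_type_iff]
    exact (algebraMap k K).injective
  · intro t _ _ i _ hit halg
    have := D_mem_span_of_isAlgebraic_adjoin halg
    rw [← Set.image_comp] at this
    exact hx.notMem_span_image hit this

/-- Extend `x` to a transcendence basis. Its differentials span `Ω[K⁄k]`, and by `h` there are
exactly as many as the dimension, so they form a basis. -/
theorem AlgebraicIndependent.linearIndependent_D {k K ι : Type*} [Field k] [Field K]
    [CharZero K] [Algebra k K] [Module.Finite K Ω[K⁄k]]
    (h : Algebra.trdeg k K = Module.finrank K Ω[K⁄k]) {x : ι → K}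
    (hx : AlgebraicIndependent k x) : LinearIndependent K (fun i => D k K (x i)) := by
  obtain ⟨t, hxt, ht⟩ := exists_isTranscendenceBasis_superset hx.to_subtype_range
  have hcard : Cardinal.mk t = Module.finrank K Ω[K⁄k] := ht.cardinalMk_eq_trdeg.trans h
  have : Finite t := by
    rw [← Cardinal.lt_aleph0_iff_finite, hcard]
    exact Cardinal.natCast_lt_aleph0
  have := Fintype.ofFinite t
  have hli : LinearIndependent K (fun a : t => D k K (a : K)) := by
    refine linearIndependent_of_top_le_span_of_card_eq_finrank ?_ ?_
    · rw [← span_range_derivation k K, Submodule.span_le]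
      rintro _ ⟨a, rfl⟩
      have := ht.isAlgebraic.isAlgebraic a
      rw [Subtype.range_coe] at this
      have := D_mem_span_of_isAlgebraic_adjoin this
      rwa [Set.image_eq_range] at this
    · rw [Cardinal.mk_fintype] at hcard
      exact_mod_cast hcard
  exact hli.comp (fun i => ⟨x i, hxt ⟨i, rfl⟩⟩) fun i j hij =>
    hx.injective (congrArg Subtype.val hij)

/-! ### The function field of affine space -/

namespace MvPolynomial

variable {σ k : Type*} [Field k] (K : Type*) [Field K] [Algebra k K] [Algebra (MvPolynomial σ k) K]
  [IsScalarTower k (MvPolynomial σ k) K] [IsFractionRing (MvPolynomial σ k) K]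

/-- The differentials of the coordinates form a basis of the differentials of the field of rational
functions. -/
noncomputable def kaehlerBasis : Module.Basis σ K Ω[K⁄k] :=
  (mvPolynomialBasis k σ).ofIsLocalizedModule K (nonZeroDivisors (MvPolynomial σ k))
    (KaehlerDifferential.map k k (MvPolynomial σ k) K)

theorem kaehlerBasis_apply (c : σ) :
    kaehlerBasis (k := k) K c = D k K (algebraMap (MvPolynomial σ k) K (X c)) := by
  have : mvPolynomialBasis k σ c = D k _ (X c) := by
    apply (mvPolynomialBasis k σ).repr.injective
    simp
  simp [kaehlerBasis, this]

theorem algebraicIndependent_algebraMap_X :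
    AlgebraicIndependent k (fun c : σ => algebraMap (MvPolynomial σ k) K (X c)) :=
  ((IsScalarTower.toAlgHom k (MvPolynomial σ k) K).algebraicIndependent_iff
    (IsFractionRing.injective (MvPolynomial σ k) K)).2 (algebraicIndependent_X σ k)

theorem trdeg_eq_finrank_kaehlerDifferential [Finite σ] :
    Algebra.trdeg k K = Module.finrank K Ω[K⁄k] := by
  have := Fintype.ofFinite σ
  have : Algebra.IsAlgebraic (MvPolynomial σ k) K :=
    IsLocalization.isAlgebraic _ (nonZeroDivisors (MvPolynomial σ k))
  have h := ((IsTranscendenceBasis.mvPolynomial σ k).algebraMap_comp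
    (A := K)).lift_cardinalMk_eq_trdeg
  rw [Module.finrank_eq_card_basis (kaehlerBasis (σ := σ) (k := k) K)]
  rw [Cardinal.mk_fintype] at h
  apply Cardinal.lift_injective
  rw [← h]
  simp

theorem algebraicIndependent_iff_linearIndependent_D [Finite σ] [CharZero k] {ι : Type*}
    {x : ι → K} :
    AlgebraicIndependent k x ↔ LinearIndependent K (fun i => D k K (x i)) := by
  have : CharZero K := charZero_of_injective_algebraMap (algebraMap k K).injective
  have : Module.Finite K Ω[K⁄k] := .of_basis (kaehlerBasis (σ := σ) (k := k) K)
  exact ⟨AlgebraicIndependent.linearIndependent_D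
    (trdeg_eq_finrank_kaehlerDifferential (σ := σ) K),
    AlgebraicIndependent.of_linearIndependent_D⟩

end MvPolynomial

/-! ### Lifting polynomial relations along a specialization -/

/-- If `π ∘ ψ` is algebraically independent on a set `T` over which all `ψ e` are algebraic, then
every polynomial relation between the `π (ψ e)` already holds between the `ψ e`. -/
theorem MvPolynomial.aeval_eq_zero_of_isAlgebraic_adjoin {k A B E : Type*} [Field k] [CommRing A]
    [IsDomain A] [CommRing B] [Algebra k A] [Algebra k B] (π : A →ₐ[k] B) {ψ : E → A} {T : Set E}
    (hind : AlgebraicIndepOn k (fun e => π (ψ e)) T)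
    (halg : ∀ e, IsAlgebraic (Algebra.adjoin k (ψ '' T)) (ψ e)) {f : MvPolynomial E k}
    (hf : aeval (fun e => π (ψ e)) f = 0) : aeval ψ f = 0 := by
  -- Independence after applying `π` makes `π` injective on the subalgebra generated by `ψ '' T`.
  have hker : ∀ x ∈ Algebra.adjoin k (ψ '' T), π x = 0 → x = 0 := by
    intro x hx hπ
    rw [Set.image_eq_range, Algebra.adjoin_range_eq_range_aeval] at hx
    obtain ⟨g, rfl⟩ := hx
    have hg : aeval (fun t : T => π (ψ t)) g = 0 := by
      rw [← hπ]
      exact (MvPolynomial.comp_aeval_apply (fun t : T => ψ t) π g).symm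
    have : g = 0 := (injective_iff_map_eq_zero _).1 hind g hg
    simp [this]
  have hmem : aeval ψ f ∈
      (Subalgebra.algebraicClosure (Algebra.adjoin k (ψ '' T)) A).restrictScalars k := by
    have : (aeval ψ).range ≤
        (Subalgebra.algebraicClosure (Algebra.adjoin k (ψ '' T)) A).restrictScalars k := by
      rw [← Algebra.adjoin_range_eq_range_aeval, Algebra.adjoin_le_iff]
      rintro _ ⟨e, rfl⟩
      exact halg e
    exact this ⟨f, rfl⟩
  by_contra h0
  -- In a domain, a nonzero algebraic element divides a nonzero element `r` of the base; here `π r =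
  -- 0`, against `hker`.
  obtain ⟨r, hr, y, hy⟩ :=
    IsAlgebraic.exists_nonzero_dvd hmem (mem_nonZeroDivisors_of_ne_zero h0)
  refine hr (Subtype.ext (hker r r.2 ?_))
  have hy' : (r : A) = aeval ψ f * y := hy
  rw [hy', map_mul, MvPolynomial.comp_aeval_apply, hf, zero_mul]

theorem IsAlgebraic.map_adjoin {k A B : Type*} [Field k] [CommRing A] [CommRing B] [Algebra k A]
    [Algebra k B] (f : A →ₐ[k] B) (hf : Function.Injective f) {s : Set A} {t : Set B}
    (hst : f '' s ⊆ t) {a : A} (ha : IsAlgebraic (Algebra.adjoin k s) a) :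
    IsAlgebraic (Algebra.adjoin k t) (f a) := by
  have hle : (Algebra.adjoin k s).map f ≤ Algebra.adjoin k t := by
    rw [AlgHom.map_adjoin]
    exact Algebra.adjoin_mono hst
  let g : Algebra.adjoin k s →ₐ[k] Algebra.adjoin k t :=
    (f.comp (Algebra.adjoin k s).val).codRestrict _ fun x => hle ⟨x, x.2, rfl⟩
  exact ha.ringHom_of_comp_eq g f
    (fun x y hxy => Subtype.ext (hf (congrArg Subtype.val hxy))) rfl

/-! ### Direct sums of sets of vectors -/

/-- By the dimension formula, additivity forces the two spans to meet in zero, so bases chosen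
separately in `s` and `t` are jointly independent. -/
theorem exists_linearIndepOn_union_of_finrank_eq_add {K M ι : Type*} [Field K] [AddCommGroup M]
    [Module K M] [FiniteDimensional K M] (v : ι → M) (s t : Set ι)
    (h : Module.finrank K (Submodule.span K (v '' (s ∪ t))) =
      Module.finrank K (Submodule.span K (v '' s)) +
        Module.finrank K (Submodule.span K (v '' t))) :
    ∃ s' ⊆ s, ∃ t' ⊆ t, LinearIndepOn K v (s' ∪ t') ∧
      v '' s ⊆ Submodule.span K (v '' s') ∧ v '' t ⊆ Submodule.span K (v '' t') := by
  obtain ⟨s', hs', -, hss, hs⟩ :=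
    exists_linearIndepOn_extension (linearIndepOn_empty K v) (Set.empty_subset s)
  obtain ⟨t', ht', -, htt, ht⟩ :=
    exists_linearIndepOn_extension (linearIndepOn_empty K v) (Set.empty_subset t)
  refine ⟨s', hs', t', ht', hs.union ht ?_, hss, htt⟩
  have := Submodule.finrank_sup_add_finrank_inf_eq (Submodule.span K (v '' s))
    (Submodule.span K (v '' t))
  rw [← Submodule.span_union, ← Set.image_union, h, Nat.add_eq_left] at this
  rw [Submodule.finrank_eq_zero] at this
  exact (disjoint_iff.2 this).mono (Submodule.span_mono (Set.image_mono hs'))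
    (Submodule.span_mono (Set.image_mono ht'))

namespace Rigidity

/-! ### The differential of the squared lengths -/

theorem map_sqLength {V R S : Type*} [CommRing R] [CommRing S] {d : ℕ} (φ : R →+* S)
    (p : V → Fin d → R) (e : Sym2 V) :
    φ (sqLength p e) = sqLength (fun v k => φ (p v k)) e := by
  induction e with
  | _ u v => simp [sqLength]

theorem derivation_sqLength {V k K M : Type*} [Fintype V] [Field k] [Field K] [Algebra k K]
    [AddCommGroup M] [Module K M] [Module k M] {d : ℕ} (δ : Derivation k K M)
    (p : V → Fin d → K) (e : Sym2 V) :
    δ (sqLength p e) = (2 : K) • ∑ c : V × Fin d, rigidityRow p e c • δ (p c.1 c.2) := by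
  classical
  induction e with
  | _ u v =>
    simp only [sqLength, rigidityRow, Sym2.lift_mk, map_sum, Fintype.sum_prod_type_right,
      add_smul, ite_smul, zero_smul, Finset.sum_add_distrib, Finset.sum_ite_eq',
      Finset.mem_univ, if_true]
    rw [← Finset.sum_add_distrib, Finset.smul_sum]
    refine Finset.sum_congr rfl fun k _ => ?_
    rw [Derivation.leibniz_pow, map_sub]
    simp only [Nat.add_one_sub_one, pow_one]
    module

/-- The universal configuration, whose coordinates are indeterminates. -/
noncomputable def universalConfiguration (V : Type*) (d : ℕ) :
    V → Fin d → MvPolynomial (V × Fin d) ℂ :=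
  fun v k => MvPolynomial.X (v, k)

/-- The squared lengths of a set of edges are algebraically independent polynomials if and only if
the rows of the rigidity matrix over the field of rational functions are linearly independent. -/
theorem algebraicIndepOn_sqLength_iff {V : Type*} [Finite V] {d : ℕ} (G : SimpleGraph V)
    (K : Type*) [Field K] [Algebra ℂ K] [Algebra (MvPolynomial (V × Fin d) ℂ) K]
    [IsScalarTower ℂ (MvPolynomial (V × Fin d) ℂ) K]
    [IsFractionRing (MvPolynomial (V × Fin d) ℂ) K] (T : Set G.edgeSet) :
    AlgebraicIndepOn ℂ (fun e : G.edgeSet => sqLength (universalConfiguration V d) e) T ↔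
      LinearIndepOn K (rigidityMatrix G
        (fun v k => algebraMap _ K (universalConfiguration V d v k))).row T := by
  have := Fintype.ofFinite V
  have hchar : CharZero K := charZero_of_injective_algebraMap (algebraMap ℂ K).injective
  let p : V → Fin d → K := fun v k => algebraMap _ K (universalConfiguration V d v k)
  let b := MvPolynomial.kaehlerBasis (σ := V × Fin d) (k := ℂ) K
  -- The factor 2 comes from differentiating squares; with it, `Ψ` sends each rigidity row to the
  -- differential of the squared length.
  let Ψ : (V × Fin d → K) ≃ₗ[K] Ω[K⁄ℂ] :=
    b.equivFun.symm.trans (LinearEquiv.smulOfUnit (Units.mk0 (2 : K) two_ne_zero))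
  have hΨ : ∀ e : G.edgeSet, KaehlerDifferential.D ℂ K
      (algebraMap _ K (sqLength (universalConfiguration V d) e)) =
        Ψ ((rigidityMatrix G p).row e) := by
    intro e
    rw [map_sqLength, derivation_sqLength]
    change _ = (2 : K) • b.equivFun.symm _
    rw [Module.Basis.equivFun_symm_apply]
    simp only [b, MvPolynomial.kaehlerBasis_apply]
    rfl
  rw [AlgebraicIndepOn, ← (IsScalarTower.toAlgHom ℂ (MvPolynomial (V × Fin d) ℂ)
    K).algebraicIndependent_iff (IsFractionRing.injective (MvPolynomial (V × Fin d) ℂ) K),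
    MvPolynomial.algebraicIndependent_iff_linearIndependent_D (σ := V × Fin d),
    LinearIndepOn, ← Ψ.toLinearMap.linearIndependent_iff Ψ.ker]
  change LinearIndependent K (fun e : T => KaehlerDifferential.D ℂ K
    (algebraMap _ K (sqLength (universalConfiguration V d) (e : G.edgeSet)))) ↔
      LinearIndependent K (fun e : T => Ψ ((rigidityMatrix G p).row e))
  simp only [hΨ]

/-- If the rank of the edge set is the sum of the ranks of two parts, then some set of edges has
algebraically independent squared lengths and, within each part, all squared lengths are algebraic
over those of the chosen edges. -/
theorem exists_algebraicIndepOn_sqLength {V : Type*} [Finite V] {d : ℕ} (G : SimpleGraph V)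
    (K : Type*) [Field K] [Algebra ℂ K] [Algebra (MvPolynomial (V × Fin d) ℂ) K]
    [IsScalarTower ℂ (MvPolynomial (V × Fin d) ℂ) K]
    [IsFractionRing (MvPolynomial (V × Fin d) ℂ) K]
    {E₁ E₂ : Set G.edgeSet} (hunion : E₁ ∪ E₂ = Set.univ)
    (hrank : rigidityRank d G Set.univ = rigidityRank d G E₁ + rigidityRank d G E₂) :
    ∃ T₁ ⊆ E₁, ∃ T₂ ⊆ E₂,
      AlgebraicIndepOn ℂ (fun e : G.edgeSet => sqLength (universalConfiguration V d) e)
        (T₁ ∪ T₂) ∧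
      (∀ e ∈ E₁, IsAlgebraic (Algebra.adjoin ℂ
        ((fun e : G.edgeSet => sqLength (universalConfiguration V d) e) '' T₁))
          (sqLength (universalConfiguration V d) e)) ∧
      (∀ e ∈ E₂, IsAlgebraic (Algebra.adjoin ℂ
        ((fun e : G.edgeSet => sqLength (universalConfiguration V d) e) '' T₂))
          (sqLength (universalConfiguration V d) e)) := by
  have hchar : CharZero K := charZero_of_injective_algebraMap (algebraMap ℂ K).injective
  let p : V → Fin d → K := fun v k => algebraMap _ K (universalConfiguration V d v k)
  have : IsScalarTower ℚ ℂ K := .of_algebraMap_eq' (Subsingleton.elim _ _)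
  -- The indeterminates are themselves a generic configuration, so the real generic rank can be
  -- computed over `K`.
  have hp : IsGeneric p := (MvPolynomial.algebraicIndependent_algebraMap_X
    (σ := V × Fin d) (k := ℂ) K).restrictScalars (algebraMap ℚ ℂ).injective
  simp only [rigidityRank,
    frameworkRank_eq_of_isGeneric G (isGeneric_genericConfiguration V d) hp] at hrank
  rw [← hunion] at hrank
  obtain ⟨T₁, hT₁, T₂, hT₂, hli, h₁, h₂⟩ :=
    exists_linearIndepOn_union_of_finrank_eq_add (K := K) (rigidityMatrix G p).row E₁ E₂ hrank
  have halg : ∀ T E : Set G.edgeSet, LinearIndepOn K (rigidityMatrix G p).row T →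
      (rigidityMatrix G p).row '' E ⊆ Submodule.span K ((rigidityMatrix G p).row '' T) →
      ∀ e ∈ E, IsAlgebraic (Algebra.adjoin ℂ
        ((fun e : G.edgeSet => sqLength (universalConfiguration V d) e) '' T))
          (sqLength (universalConfiguration V d) e) := by
    intro T E hT hspan e he
    -- A transcendental length would extend `T` to an algebraically independent set, making the row
    -- of `e` independent of the rows of `T`.
    by_contra htr
    have heT : e ∉ T := fun heT => htr (isAlgebraic_algebraMap
      (⟨_, Algebra.subset_adjoin ⟨e, heT, rfl⟩⟩ : Algebra.adjoin ℂ
        ((fun e : G.edgeSet => sqLength (universalConfiguration V d) e) '' T)))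
    have := (AlgebraicIndepOn.insert_iff heT).2
      ⟨(algebraicIndepOn_sqLength_iff G K T).2 hT, htr⟩
    rw [algebraicIndepOn_sqLength_iff G K, linearIndepOn_insert heT] at this
    exact this.2 (hspan ⟨e, he, rfl⟩)
  exact ⟨T₁, hT₁, T₂, hT₂, (algebraicIndepOn_sqLength_iff G K _).2 hli,
    halg _ _ (hli.mono Set.subset_union_left) h₁, halg _ _ (hli.mono Set.subset_union_right) h₂⟩

/-! ### Zariski closures -/

theorem subset_zariskiClosure {σ : Type*} (S : Set (σ → ℂ)) : S ⊆ zariskiClosure S :=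
  MvPolynomial.zeroLocus_vanishingIdeal_le S

/-- A polynomial map that sends `S` into the Zariski closed set `zariskiClosure S'` sends
`zariskiClosure S` into it as well. -/
theorem mapsTo_zariskiClosure {σ τ : Type*} {S : Set (σ → ℂ)} {S' : Set (τ → ℂ)}
    {g : (σ → ℂ) → τ → ℂ} (P : τ → MvPolynomial σ ℂ)
    (hP : ∀ x t, g x t = MvPolynomial.aeval x (P t))
    (h : Set.MapsTo g S (zariskiClosure S')) :
    Set.MapsTo g (zariskiClosure S) (zariskiClosure S') := by
  intro x hx f hf
  have key : ∀ y, MvPolynomial.aeval (g y) f =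
      MvPolynomial.aeval y (MvPolynomial.bind₁ P f) := by
    intro y
    rw [MvPolynomial.aeval_bind₁]
    congr 2
    funext t
    exact hP y t
  rw [key]
  exact hx _ fun y hy => by rw [← key]; exact h hy f hf

/-! ### The measurement variety of a direct sum -/

theorem measurementMap_edgeInclusion {V : Type*} {d : ℕ} (G : SimpleGraph V) (F : Set G.edgeSet)
    (p : V → Fin d → ℂ) (i : (edgeInduced G F).coe.edgeSet) :
    measurementMap d G p (edgeInclusion G F i) =
      measurementMap d (edgeInduced G F).coe (fun v => p v) i := by
  obtain ⟨e, he⟩ := i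
  induction e with
  | _ u v => rfl

theorem exists_measurementMap_edgeInclusion_eq {V : Type*} {d : ℕ} (G : SimpleGraph V)
    (F : Set G.edgeSet) (q : (edgeInduced G F).verts → Fin d → ℂ) :
    ∃ p : V → Fin d → ℂ, ∀ i, measurementMap d (edgeInduced G F).coe q i =
      measurementMap d G p (edgeInclusion G F i) := by
  classical
  -- Vertices outside the subgraph meet none of its edges, so the value 0 there is harmless.
  refine ⟨fun v => if h : v ∈ (edgeInduced G F).verts then q ⟨v, h⟩ else 0, fun i => ?_⟩
  rw [measurementMap_edgeInclusion]
  congr 1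
  funext v
  simp

theorem splitEquiv_fst {V : Type*} (G : SimpleGraph V) {E₁ E₂ : Set G.edgeSet}
    (hdisj : Disjoint E₁ E₂) (hunion : E₁ ∪ E₂ = Set.univ) (x : G.edgeSet → ℂ)
    (i : (edgeInduced G E₁).coe.edgeSet) :
    (splitEquiv G hdisj hunion x).1 i = x (edgeInclusion G E₁ i) := rfl

theorem splitEquiv_snd {V : Type*} (G : SimpleGraph V) {E₁ E₂ : Set G.edgeSet}
    (hdisj : Disjoint E₁ E₂) (hunion : E₁ ∪ E₂ = Set.univ) (x : G.edgeSet → ℂ)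
    (i : (edgeInduced G E₂).coe.edgeSet) :
    (splitEquiv G hdisj hunion x).2 i = x (edgeInclusion G E₂ i) := rfl

open scoped Classical in
/-- If the rank of the edge set is the sum of the ranks of two parts, the squared lengths of the two
parts may be taken from two independent configurations without leaving the measurement variety. -/
theorem ite_sqLength_mem_measurementVariety {V : Type*} [Finite V] {d : ℕ} (G : SimpleGraph V)
    {E₁ E₂ : Set G.edgeSet} (hdisj : Disjoint E₁ E₂) (hunion : E₁ ∪ E₂ = Set.univ)
    (hrank : rigidityRank d G Set.univ = rigidityRank d G E₁ + rigidityRank d G E₂)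
    (p q : V → Fin d → ℂ) :
    (fun e : G.edgeSet => if e ∈ E₁ then measurementMap d G p e else measurementMap d G q e) ∈
      measurementVariety d G := by
  obtain ⟨T₁, hT₁, T₂, hT₂, hind, h₁, h₂⟩ :=
    exists_algebraicIndepOn_sqLength G (FractionRing (MvPolynomial (V × Fin d) ℂ)) hunion hrank
  let m : G.edgeSet → MvPolynomial (V × Fin d) ℂ :=
    fun e => sqLength (universalConfiguration V d) e
  let j₁ : MvPolynomial (V × Fin d) ℂ →ₐ[ℂ] MvPolynomial ((V × Fin d) ⊕ (V × Fin d)) ℂ :=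
    MvPolynomial.rename Sum.inl
  let j₂ : MvPolynomial (V × Fin d) ℂ →ₐ[ℂ] MvPolynomial ((V × Fin d) ⊕ (V × Fin d)) ℂ :=
    MvPolynomial.rename Sum.inr
  let ψ : G.edgeSet → MvPolynomial ((V × Fin d) ⊕ (V × Fin d)) ℂ :=
    fun e => if e ∈ E₁ then j₁ (m e) else j₂ (m e)
  -- Restriction to the diagonal, identifying the two copies of the variables.
  let π : MvPolynomial ((V × Fin d) ⊕ (V × Fin d)) ℂ →ₐ[ℂ] MvPolynomial (V × Fin d) ℂ :=
    MvPolynomial.rename (Sum.elim id id)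
  have hψ₁ : ∀ e ∈ E₁, ψ e = j₁ (m e) := fun e he => if_pos he
  have hψ₂ : ∀ e ∈ E₂, ψ e = j₂ (m e) := fun e he => if_neg (Set.disjoint_right.1 hdisj he)
  have hπ : (fun e => π (ψ e)) = m := by
    funext e
    have h₁ : π (j₁ (m e)) = m e := by
      simp only [π, j₁, MvPolynomial.rename_rename, Sum.elim_comp_inl, MvPolynomial.rename_id_apply]
    have h₂ : π (j₂ (m e)) = m e := by
      simp only [π, j₂, MvPolynomial.rename_rename, Sum.elim_comp_inr, MvPolynomial.rename_id_apply]
    by_cases he : e ∈ E₁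
    · simp only [ψ, if_pos he, h₁]
    · simp only [ψ, if_neg he, h₂]
  have halg : ∀ e, IsAlgebraic (Algebra.adjoin ℂ (ψ '' (T₁ ∪ T₂))) (ψ e) := by
    intro e
    rcases hunion.ge (Set.mem_univ e) with he | he
    · rw [hψ₁ e he]
      refine (h₁ e he).map_adjoin j₁ (MvPolynomial.rename_injective _ Sum.inl_injective) ?_
      rintro _ ⟨_, ⟨t, ht, rfl⟩, rfl⟩
      exact ⟨t, Or.inl ht, hψ₁ t (hT₁ ht)⟩
    · rw [hψ₂ e he]
      refine (h₂ e he).map_adjoin j₂ (MvPolynomial.rename_injective _ Sum.inr_injective) ?_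
      rintro _ ⟨_, ⟨t, ht, rfl⟩, rfl⟩
      exact ⟨t, Or.inr ht, hψ₂ t (hT₂ ht)⟩
  have hm : ∀ r : V → Fin d → ℂ, ∀ e : G.edgeSet,
      MvPolynomial.aeval (fun c : V × Fin d => r c.1 c.2) (m e) = measurementMap d G r e := by
    intro r e
    change (MvPolynomial.aeval _).toRingHom _ = _
    rw [map_sqLength]
    simp [universalConfiguration, measurementMap]
  intro f hf
  -- Vanishing at all complex configurations is a polynomial identity because `ℂ` is infinite.
  have hf0 : MvPolynomial.aeval m f = 0 := by
    apply MvPolynomial.funext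
    intro x
    have := hf (measurementMap d G fun v k => x (v, k)) ⟨_, rfl⟩
    rw [map_zero, ← this, ← MvPolynomial.coe_aeval_eq_eval]
    change MvPolynomial.aeval x _ = _
    rw [MvPolynomial.comp_aeval_apply]
    congr 2
    funext e
    exact hm (fun v k => x (v, k)) e
  have hψ0 := MvPolynomial.aeval_eq_zero_of_isAlgebraic_adjoin π (hπ ▸ hind) halg (hπ ▸ hf0)
  let ev : MvPolynomial ((V × Fin d) ⊕ (V × Fin d)) ℂ →ₐ[ℂ] ℂ :=
    MvPolynomial.aeval (Sum.elim (fun c => p c.1 c.2) fun c => q c.1 c.2)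
  have := congrArg ev hψ0
  rw [MvPolynomial.comp_aeval_apply, map_zero] at this
  rw [← this]
  congr 2
  funext e
  simp only [ψ, apply_ite ev, j₁, j₂, ev, MvPolynomial.aeval_rename, Sum.elim_comp_inl,
    Sum.elim_comp_inr, hm]

theorem splitEquiv_symm_mem_measurementVariety {V : Type*} [Finite V] {d : ℕ} (G : SimpleGraph V)
    {E₁ E₂ : Set G.edgeSet} (hdisj : Disjoint E₁ E₂) (hunion : E₁ ∪ E₂ = Set.univ)
    (hrank : rigidityRank d G Set.univ = rigidityRank d G E₁ + rigidityRank d G E₂)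
    {a : (edgeInduced G E₁).coe.edgeSet → ℂ} {b : (edgeInduced G E₂).coe.edgeSet → ℂ}
    (ha : a ∈ measurementVariety d (edgeInduced G E₁).coe)
    (hb : b ∈ measurementVariety d (edgeInduced G E₂).coe) :
    (splitEquiv G hdisj hunion).symm (a, b) ∈ measurementVariety d G := by
  classical
  have hsurj : ∀ e : G.edgeSet, ∃ s, Sum.elim (edgeInclusion G E₁) (edgeInclusion G E₂) s = e := by
    intro e
    rw [← Set.mem_range, Set.Sum.elim_range, range_edgeInclusion, range_edgeInclusion, hunion]
    trivial
  choose s hs using hsurj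
  have hinl : ∀ a b i,
      (splitEquiv G hdisj hunion).symm (a, b) (edgeInclusion G E₁ i) = a i := by
    intro a b i
    rw [← splitEquiv_fst G hdisj hunion ((splitEquiv G hdisj hunion).symm (a, b)),
      LinearEquiv.apply_symm_apply]
  have hinr : ∀ a b i,
      (splitEquiv G hdisj hunion).symm (a, b) (edgeInclusion G E₂ i) = b i := by
    intro a b i
    rw [← splitEquiv_snd G hdisj hunion ((splitEquiv G hdisj hunion).symm (a, b)),
      LinearEquiv.apply_symm_apply]
  have hsymm : ∀ a b e, (splitEquiv G hdisj hunion).symm (a, b) e = Sum.elim a b (s e) := by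
    intro a b e
    conv_lhs => rw [← hs e]
    rcases s e with i | i
    · exact hinl a b i
    · exact hinr a b i
  -- A product of closures lies in the closure of the product: fix `b` and reduce `a` to an actual
  -- measurement, then fix that measurement and reduce `b` likewise.
  refine mapsTo_zariskiClosure (g := fun a => (splitEquiv G hdisj hunion).symm (a, b))
    (fun e => Sum.elim MvPolynomial.X (fun i => MvPolynomial.C (b i)) (s e)) ?_ ?_ ha
  · intro a e
    rw [hsymm]
    rcases s e with i | i <;> simp
  rintro _ ⟨p', rfl⟩
  refine mapsTo_zariskiClosure (g := fun b => (splitEquiv G hdisj hunion).symm (_, b))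
    (fun e => Sum.elim (fun i => MvPolynomial.C (measurementMap d _ p' i)) MvPolynomial.X (s e))
    ?_ ?_ hb
  · intro b e
    rw [hsymm]
    rcases s e with i | i <;> simp
  rintro _ ⟨q', rfl⟩
  obtain ⟨p, hp⟩ := exists_measurementMap_edgeInclusion_eq G E₁ p'
  obtain ⟨q, hq⟩ := exists_measurementMap_edgeInclusion_eq G E₂ q'
  refine Set.mem_of_eq_of_mem ?_ (ite_sqLength_mem_measurementVariety G hdisj hunion hrank p q)
  funext e
  rw [← hs e]
  rcases s e with i | i
  · have hi : edgeInclusion G E₁ i ∈ E₁ := (range_edgeInclusion G E₁).le ⟨i, rfl⟩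
    exact (hinl _ _ i).trans ((hp i).trans (if_pos hi).symm)
  · have hi : edgeInclusion G E₂ i ∈ E₂ := (range_edgeInclusion G E₂).le ⟨i, rfl⟩
    exact (hinr _ _ i).trans ((hq i).trans (if_neg (Set.disjoint_right.1 hdisj hi)).symm)

theorem comp_edgeInclusion_mem_measurementVariety {V : Type*} {d : ℕ} (G : SimpleGraph V)
    (F : Set G.edgeSet) {x : G.edgeSet → ℂ} (hx : x ∈ measurementVariety d G) :
    (fun i => x (edgeInclusion G F i)) ∈ measurementVariety d (edgeInduced G F).coe := by
  refine mapsTo_zariskiClosure (g := fun x i => x (edgeInclusion G F i))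
    (fun i => MvPolynomial.X (edgeInclusion G F i)) (fun x i => by simp) ?_ hx
  rintro _ ⟨p, rfl⟩
  exact subset_zariskiClosure _ ⟨fun v => p v, funext fun i =>
    (measurementMap_edgeInclusion G F p i).symm⟩

end Rigidity

theorem lemma3p1 {V : Type*} [Finite V] (d : ℕ) (hd : 1 ≤ d) (G : SimpleGraph V)
    (E₁ E₂ : Set G.edgeSet) (hE₁ : E₁.Nonempty) (hE₂ : E₂.Nonempty)
    (hdisj : Disjoint E₁ E₂) (hunion : E₁ ∪ E₂ = Set.univ)
    (hrank : Rigidity.rigidityRank d G Set.univ =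
      Rigidity.rigidityRank d G E₁ + Rigidity.rigidityRank d G E₂) :
    Rigidity.splitEquiv G hdisj hunion '' Rigidity.measurementVariety d G =
      Rigidity.measurementVariety d (Rigidity.edgeInduced G E₁).coe ×ˢ
        Rigidity.measurementVariety d (Rigidity.edgeInduced G E₂).coe := by
  ext ⟨a, b⟩
  constructor
  · rintro ⟨x, hx, hxab⟩
    rw [← hxab]
    exact ⟨Rigidity.comp_edgeInclusion_mem_measurementVariety G E₁ hx,
      Rigidity.comp_edgeInclusion_mem_measurementVariety G E₂ hx⟩
  · rintro ⟨ha, hb⟩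
    exact ⟨_, Rigidity.splitEquiv_symm_mem_measurementVariety G hdisj hunion hrank ha hb,
      LinearEquiv.apply_symm_apply _ _⟩
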